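/- Let $(W,S)$ be a Coxeter system with $S=\{s_1,\dots,s_n\}$ and Coxeter matrix $(m_{ij})$, $m_{ij}\in\mathbb Z_{\ge 1}\cup\{\infty\}$, and let $V=\mathbb R^n$ with orthonormal basis $\Delta=\{\alpha_1,\dots,\alpha_n\}$. Let $B$ be a symmetric bilinear form on $V$ with $B(\alpha_i,\alpha_j)=-\cos(\pi/m_{ij})$ if $m_{ij}<\infty$ and $B(\alpha_i,\alpha_j)\le -1$ if $m_{ij}=\infty$. Assume that $B$ has signature $(n-1,1)$ and that its Gram matrix is irreducible (not block-diagonal up to a permutation of the basis). Let $W$ act linearly on $V$ by $s_i(v)=v-2\frac{B(\alpha_i,v)}{B(\alpha_i,\alpha_i)}\alpha_i$. Let $o=\sum_i o_i\alpha_i$ be the Euclidean unit eigenvector of the Gram matrix of $B$ for its negative eigenvalue with all $o_i>0$, put $|v|_1=\sum_i o_iv_i$ for $v=\sum_i v_i\alpha_i$, and let $$D=\{v\in V: |v|_1=1,\ B(v,v)<0\},\qquad \partial D=\{v\in V: |v|_1=1,\ B(v,v)=0\}.$$ The normalized action is $w\cdot v=w(v)/|w(v)|_1$. The Hilbert metric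 on $D$ is $d(x,y)=\log\frac{\|y-a\|\,\|x-b\|}{\|y-b\|\,\|x-a\|}$, where $a,b\in\partial D$ are such that $a,x,y,b$ lie in this order on the segment from $a$ to $b$. An isometry $\gamma$ of $(D,d)$ is called parabolic if $\inf_{x\in D}d(x,\gamma(x))$ is not attained in $D$. Let $S'\subset S$ be a non-empty subset such that the restriction $B'$ of $B$ to the span of the roots corresponding to $S'$ has signature $(|S'|-1,0)$, so that the special subgroup $W'=\langle S'\rangle$ is affine. Then every element $w\in W'$ of infinite order acts on $(D,d)$, by the normalized action, as a parabolic isometry. Moreover, the normalized action of $w$ fixes exactly one point $\xi$ of $\partial D$, and $w(\xi)=\xi$, i.e. $\xi$ is an eigenvector of $w$ for the eigenvalue $1$. -/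

import Mathlib

/-! Coxeter groups acting on the Hilbert geometry of a form of signature `(n - 1, 1)`. -/

open scoped Real

noncomputable section

namespace CoxeterHilbert

/-- The symmetric bilinear form on the Euclidean space `ℝ^κ` whose Gram matrix in the standard
orthonormal basis is `A`. -/
def gramForm {κ : Type*} [Fintype κ] [DecidableEq κ] (A : Matrix κ κ ℝ) :
    LinearMap.BilinForm ℝ (EuclideanSpace ℝ κ) :=
  Matrix.toBilin (EuclideanSpace.basisFun κ ℝ).toBasis A

/-- The form with Gram matrix `A` has signature `(p, q)`: `p` is the positive and `q` the negative
index of inertia (the zero part may be nontrivial). -/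
def HasSignature {κ : Type*} [Fintype κ] [DecidableEq κ] (A : Matrix κ κ ℝ) (p q : ℕ) : Prop :=
  sigPos (gramForm A).toQuadraticMap = p ∧
    sigNeg (gramForm A).toQuadraticMap = q

/-- `A` is the Gram matrix `(B(α_i, α_j))` of a based form for the Coxeter matrix `M`.
In Mathlib an entry `M i j = 0` stands for `m_{ij} = ∞`. -/
structure IsCoxeterGram {ι : Type*} (M : CoxeterMatrix ι) (A : Matrix ι ι ℝ) : Prop where
  symm : A.IsSymm
  finite_label : ∀ i j, M i j ≠ 0 → A i j = -Real.cos (π / (M i j : ℝ))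
  infinite_label : ∀ i j, M i j = 0 → A i j ≤ -1

/-- `A` is not block-diagonal up to a permutation of the basis. -/
def IsIrreducibleGram {ι : Type*} (A : Matrix ι ι ℝ) : Prop :=
  ∀ I : Set ι, I.Nonempty → Iᶜ.Nonempty → ∃ i ∈ I, ∃ j ∈ Iᶜ, A i j ≠ 0

/-- The `B`-reflection `v ↦ v - 2 (B(a, v) / B(a, a)) a`. -/
def bReflection {V : Type*} [AddCommGroup V] [Module ℝ V] (B : LinearMap.BilinForm ℝ V) (a : V) :
    Module.End ℝ V :=
  Module.preReflection a ((2 / B a a) • B a)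

theorem bReflection_apply {V : Type*} [AddCommGroup V] [Module ℝ V]
    (B : LinearMap.BilinForm ℝ V) (a v : V) :
    bReflection B a v = v - (2 * (B a v / B a a)) • a := by
  simp only [bReflection, Module.preReflection_apply, LinearMap.smul_apply, smul_eq_mul]
  congr 2
  ring

section

variable {ι : Type*} [Fintype ι] [DecidableEq ι]

/-- The simple root `α_i`, a member of the standard orthonormal basis. -/
def simpleRoot (i : ι) : EuclideanSpace ℝ ι := EuclideanSpace.basisFun ι ℝ i

theorem gramForm_simpleRoot (A : Matrix ι ι ℝ) (i j : ι) :
    gramForm A (simpleRoot i) (simpleRoot j) = A i j := by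
  have h := Matrix.toBilin_basisFun (R₁ := ℝ) (n := ι)
  have := LinearMap.BilinForm.toMatrix_apply (EuclideanSpace.basisFun ι ℝ).toBasis (gramForm A) i j
  simp only [gramForm, LinearMap.BilinForm.toMatrix_toBilin] at this
  rw [this]
  simp [gramForm, simpleRoot]

/-- Two reflections whose roots span an angle `π - π / m` satisfy the braid relation. -/
theorem reflection_mul_pow {V : Type*} [AddCommGroup V] [Module ℝ V] {x y : V}
    {f g : Module.Dual ℝ V} (hf : f x = 2) (hg : g y = 2) (m : ℕ) (hm : 2 ≤ m)
    (hfy : f y = -2 * Real.cos (π / m)) (hgx : g x = -2 * Real.cos (π / m)) :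
    (Module.reflection hf * Module.reflection hg) ^ m = 1 := by
  have hm0 : (m : ℝ) ≠ 0 := by positivity
  have ht : (2 * Real.cos (2 * (π / m)) : ℝ) = f y * g x - 2 := by
    rw [hfy, hgx, Real.cos_two_mul]; ring
  ext z
  rw [Module.reflection_mul_reflection_pow_apply hf hg m z _ ht]
  simp only [LinearEquiv.coe_one, id_eq]
  have hS := fun n : ℤ => Polynomial.Chebyshev.S_two_mul_real_cos (2 * (π / m)) n
  rcases hm.eq_or_lt with rfl | hm3
  · have h1 : f y = 0 := by rw [hfy]; norm_num
    have h2 : g x = 0 := by rw [hgx]; norm_num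
    have h3 : 2 * Real.cos (2 * (π / (2 : ℕ))) = -2 := by
      rw [show 2 * (π / (2 : ℕ)) = π by push_cast; ring, Real.cos_pi]; norm_num
    rw [h3, h1, h2]
    norm_num
    module
  · have hs : Real.sin (2 * (π / m)) ≠ 0 := by
      apply ne_of_gt
      apply Real.sin_pos_of_pos_of_lt_pi
      · positivity
      · have h3 : (2 : ℝ) < m := by exact_mod_cast hm3
        rw [← mul_div_assoc, div_lt_iff₀ (by positivity)]
        nlinarith [Real.pi_pos]
    obtain ⟨k, rfl | rfl⟩ := m.even_or_odd'
    · have e1 : ((2 * k : ℕ) - 2 : ℤ) / 2 = k - 1 := by lia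
      have e2 : ((2 * k : ℕ) - 1 : ℤ) / 2 = k - 1 := by lia
      have h0 := hS (k - 1)
      have : ((((k : ℤ) - 1 : ℤ) : ℝ) + 1) * (2 * (π / (2 * k : ℕ))) = π := by
        have hk : (k : ℝ) ≠ 0 := by
          intro h
          simp [h] at hm0
        push_cast
        field_simp
        ring
      rw [this, Real.sin_pi] at h0
      have h0 := (mul_eq_zero.1 h0).resolve_right hs
      rw [e1, e2, h0]
      simp
    · have e1 : ((2 * k + 1 : ℕ) - 1 : ℤ) / 2 = k := by lia
      have e2 : ((2 * k + 1 : ℕ) - 3 : ℤ) / 2 = k - 1 := by lia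
      have e3 : ((2 * k + 1 : ℕ) : ℤ) / 2 = k := by lia
      have e4 : ((2 * k + 1 : ℕ) - 2 : ℤ) / 2 = k - 1 := by lia
      have h0 := hS k
      have h1 := hS (k - 1)
      have a0 : (((k : ℤ) : ℝ) + 1) * (2 * (π / (2 * k + 1 : ℕ))) = π + π / (2 * k + 1 : ℕ) := by
        push_cast at hm0 ⊢
        field_simp
        ring
      have a1 : ((((k : ℤ) - 1 : ℤ) : ℝ) + 1) * (2 * (π / (2 * k + 1 : ℕ)))
          = π - π / (2 * k + 1 : ℕ) := by
        push_cast at hm0 ⊢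
        field_simp
        ring
      rw [a0, Real.sin_add] at h0
      rw [a1, Real.sin_sub] at h1
      simp only [Real.sin_pi, Real.cos_pi] at h0 h1
      have h2 := (mul_eq_zero.1 (show ((Polynomial.Chebyshev.S ℝ k).eval
          (2 * Real.cos (2 * (π / (2 * k + 1 : ℕ)))) + (Polynomial.Chebyshev.S ℝ (k - 1)).eval
          (2 * Real.cos (2 * (π / (2 * k + 1 : ℕ))))) * Real.sin (2 * (π / (2 * k + 1 : ℕ))) = 0 by
        rw [add_mul, h0, h1]; ring)).resolve_right hs
      rw [e1, e2, e3, e4, h2]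
      simp

/-- The simple reflections satisfy the Coxeter relations. -/
theorem isLiftable_bReflection {M : CoxeterMatrix ι} {A : Matrix ι ι ℝ} (hA : IsCoxeterGram M A) :
    M.IsLiftable fun i => bReflection (gramForm A) (simpleRoot i) := by
  have hd (i : ι) : gramForm A (simpleRoot i) (simpleRoot i) = 1 := by
    rw [gramForm_simpleRoot, hA.finite_label i i (by simp)]
    simp
  have h2 (i : ι) : ((2 : ℝ) • gramForm A (simpleRoot i)) (simpleRoot i) = 2 := by
    simp [hd]
  have hr (i : ι) : bReflection (gramForm A) (simpleRoot i)
      = (Module.reflection (h2 i)).toLinearMap := by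
    ext1 v
    rw [bReflection_apply, LinearEquiv.coe_coe, Module.reflection_apply, hd]
    simp
  intro i j
  show (bReflection (gramForm A) (simpleRoot i) * bReflection (gramForm A) (simpleRoot j)) ^ M i j
    = 1
  have key : (Module.reflection (h2 i) * Module.reflection (h2 j)) ^ M i j = 1 := by
    by_cases hij : i = j
    · subst hij
      ext1 v
      simp [Module.involutive_reflection (h2 i) v]
    · by_cases h0 : M i j = 0
      · rw [h0, pow_zero]
      · have h1 := M.off_diagonal i j hij
        apply reflection_mul_pow (h2 i) (h2 j) (M i j) (by lia)
        · simp [gramForm_simpleRoot, hA.finite_label i j h0]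
        · rw [LinearMap.smul_apply, gramForm_simpleRoot, ← hA.symm.apply,
            hA.finite_label i j h0, smul_eq_mul]
          ring
  rw [hr, hr]
  ext1 v
  have := congrArg (fun e : EuclideanSpace ℝ ι ≃ₗ[ℝ] EuclideanSpace ℝ ι => e v) key
  have hpow : ∀ (n : ℕ) (v : EuclideanSpace ℝ ι),
      ((((Module.reflection (h2 i)).toLinearMap * (Module.reflection (h2 j)).toLinearMap) ^ n :
        Module.End ℝ (EuclideanSpace ℝ ι)) v)
        = ((Module.reflection (h2 i) * Module.reflection (h2 j)) ^ n) v := by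
    intro n
    induction n with
    | zero => intro v; simp
    | succ n ih =>
      intro v
      rw [pow_succ, pow_succ, LinearEquiv.mul_apply, ← ih]
      rfl
  rw [hpow]
  exact this

/-- The linear action of the Coxeter group on `ℝ^ι` in which the generator `s_i` acts as the
`B`-reflection in `α_i`. -/
def linearAction {M : CoxeterMatrix ι} {W : Type*} [Group W] (cs : CoxeterSystem M W)
    {A : Matrix ι ι ℝ} (hA : IsCoxeterGram M A) : W →* Module.End ℝ (EuclideanSpace ℝ ι) :=
  cs.lift ⟨fun i => bReflection (gramForm A) (simpleRoot i), isLiftable_bReflection hA⟩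

theorem linearAction_simple {M : CoxeterMatrix ι} {W : Type*} [Group W] (cs : CoxeterSystem M W)
    {A : Matrix ι ι ℝ} (hA : IsCoxeterGram M A) (i : ι) :
    linearAction cs hA (cs.simple i) = bReflection (gramForm A) (simpleRoot i) :=
  cs.lift_apply_simple (isLiftable_bReflection hA) i

/-- `o` is a Euclidean unit eigenvector of `A` for a negative eigenvalue, all of whose coordinates
are positive. -/
def IsNormalizedEigenvector (A : Matrix ι ι ℝ) (o : EuclideanSpace ℝ ι) : Prop :=
  (∃ μ < 0, Module.End.HasEigenvector (Matrix.toEuclideanLin A) μ o) ∧ ‖o‖ = 1 ∧ ∀ i, 0 < o i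

/-- The normalized eigenvector `o` for the negative eigenvalue. For an irreducible Gram matrix of
signature `(n - 1, 1)` there is exactly one vector as in `IsNormalizedEigenvector`. -/
def normalizedEigenvector (A : Matrix ι ι ℝ) : EuclideanSpace ℝ ι :=
  Classical.epsilon (IsNormalizedEigenvector A)

/-- `|v|₁ = ∑ i, o_i v_i`. -/
def height (A : Matrix ι ι ℝ) (v : EuclideanSpace ℝ ι) : ℝ :=
  ∑ i, normalizedEigenvector A i * v i

/-- The normalization `v / |v|₁` (meaningful when `|v|₁ ≠ 0`). -/
def normalize (A : Matrix ι ι ℝ) (v : EuclideanSpace ℝ ι) : EuclideanSpace ℝ ι :=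
  (height A v)⁻¹ • v

/-- The domain `D = {v | |v|₁ = 1, B(v, v) < 0}`. -/
def domain (A : Matrix ι ι ℝ) : Set (EuclideanSpace ℝ ι) :=
  {v | height A v = 1 ∧ gramForm A v v < 0}

/-- The boundary `∂D = {v | |v|₁ = 1, B(v, v) = 0}`. -/
def domainBoundary (A : Matrix ι ι ℝ) : Set (EuclideanSpace ℝ ι) :=
  {v | height A v = 1 ∧ gramForm A v v = 0}

/-- The normalized action of `w` sends `v` to `w(v) / |w(v)|₁`. -/
def normalizedAction {M : CoxeterMatrix ι} {W : Type*} [Group W] (cs : CoxeterSystem M W)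
    {A : Matrix ι ι ℝ} (hA : IsCoxeterGram M A) (w : W) (v : EuclideanSpace ℝ ι) :
    EuclideanSpace ℝ ι :=
  normalize A (linearAction cs hA w v)

/-- The generators indexed by `J` generate an affine special subgroup: the restriction of the form
to the roots `α_j`, `j ∈ J`, has signature `(|J| - 1, 0)`. -/
def IsAffineSubset (A : Matrix ι ι ℝ) (J : Finset ι) : Prop :=
  J.Nonempty ∧
    HasSignature (A.submatrix (Subtype.val : J → ι) (Subtype.val : J → ι)) (J.card - 1) 0

/-- The special subgroup generated by the `s_j` with `j ∈ J`. -/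
def specialSubgroup {M : CoxeterMatrix ι} {W : Type*} [Group W] (cs : CoxeterSystem M W)
    (J : Finset ι) : Subgroup W :=
  Subgroup.closure (cs.simple '' (J : Set ι))

end

/-- The cross ratio `[a, x, y, b] = (‖y - a‖ ‖x - b‖) / (‖y - b‖ ‖x - a‖)`. -/
def crossRatio {E : Type*} [NormedAddCommGroup E] (a x y b : E) : ℝ :=
  (‖y - a‖ * ‖x - b‖) / (‖y - b‖ * ‖x - a‖)

open Classical in
/-- The Hilbert distance `log [a, x, y, b]`, where `a, b` are points of the boundary `S` such that
`a, x, y, b` lie in this order on the segment from `a` to `b`.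
(For `x = y` the value is `0` for every admissible pair, and for distinct points of a bounded
convex domain the pair is unique.) -/
def hilbertDist {E : Type*} [NormedAddCommGroup E] [NormedSpace ℝ E] (S : Set E) (x y : E) : ℝ :=
  if h : ∃ p : E × E, p.1 ∈ S ∧ p.2 ∈ S ∧ x ∈ segment ℝ p.1 p.2 ∧ y ∈ segment ℝ x p.2 then
    Real.log (crossRatio h.choose.1 x y h.choose.2)
  else 0

/-- `γ` restricts to an isometry of `X` onto itself for the distance function `δ`. -/
def IsIsometryOf {E : Type*} (X : Set E) (δ : E → E → ℝ) (γ : E → E) : Prop :=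
  Set.BijOn γ X X ∧ ∀ x ∈ X, ∀ y ∈ X, δ (γ x) (γ y) = δ x y

/-- The translation length `inf {δ(x, γ x) | x ∈ X}`. -/
def translationLength {E : Type*} (X : Set E) (δ : E → E → ℝ) (γ : E → E) : ℝ :=
  sInf ((fun x => δ x (γ x)) '' X)

/-- A parabolic isometry of `X`: its translation length is not attained. -/
def IsParabolicIsometryOf {E : Type*} (X : Set E) (δ : E → E → ℝ) (γ : E → E) : Prop :=
  IsIsometryOf X δ γ ∧ ¬ ∃ x ∈ X, δ x (γ x) = translationLength X δ γ

end CoxeterHilbert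

end

/-!
# Infinite-order elements of affine special subgroups are parabolic

Since `B` has signature `(n - 1, 1)` and `|v|₁` is proportional to `B(o, v)` for the timelike
Perron–Frobenius vector `o` (`exists_isNormalizedEigenvector`), the form is positive definite on
the kernel of the height (`isTimeOriented_heightForm`). Everything metric follows from this fact:
the domain is the Klein model of hyperbolic space, its Hilbert distance is given by
`cosh d(x, y) = 2 B(x, y)² / (B(x, x) B(y, y)) - 1` (`cosh_hilbertDist`), and reflections in
spacelike vectors preserve both halves of the light cone, so that `W` acts by isometries.

An affine special subgroup fixes a null vector `ξ`: the radical of the restricted form consists of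
vectors orthogonal to all roots that generate the subgroup
(`exists_null_vector_of_isAffineSubset`). If `w` fixes `ξ` but no point of the domain, it is
parabolic, because moving `x` towards `ξ` strictly decreases `d(x, w x)`
(`PreservesCone.isParabolicIsometryOf`), and a second fixed boundary point would produce a fixed
midpoint inside the domain (`PreservesCone.eq_of_chartAction_eq`).

That an element of infinite order has no fixed point in the domain uses that `W` is discrete. If
`i` is not a right descent of `w`, then `w α_i` has nonnegative coordinates
(`linearAction_simpleRoot_nonneg`, by induction on the length and reduction to dihedral
subgroups). So a nontrivial element makes the `i`-th coordinate of some `w α_i` nonpositive, and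
the identity is isolated. The powers of an element that fixes a timelike vector preserve a positive
definite form, hence are bounded, and two of them coincide
(`isOfFinOrder_of_linearAction_eq`).
-/

namespace CoxeterHilbert

/-! ### Forms that are positive on the kernel of a functional -/

/-- A symmetric form `B` and a functional `f` such that `B` is positive definite on `ker f`. The
set `{f > 0, B < 0}` is then one of the two halves of the light cone, and `f` is used to normalize
its vectors to the affine chart `f = 1`. -/
structure IsTimeOriented {E : Type*} [AddCommGroup E] [Module ℝ E] (B : LinearMap.BilinForm ℝ E)
    (f : Module.Dual ℝ E) : Prop where
  symm : ∀ u v, B u v = B v u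
  pos_of_ker : ∀ u, f u = 0 → u ≠ 0 → 0 < B u u

namespace IsTimeOriented

variable {E : Type*} [AddCommGroup E] [Module ℝ E] {B : LinearMap.BilinForm ℝ E}
  {f : Module.Dual ℝ E}

theorem nonneg_of_ker (h : IsTimeOriented B f) {u : E} (hu : f u = 0) : 0 ≤ B u u := by
  by_cases h0 : u = 0
  · simp [h0]
  · exact (h.pos_of_ker u hu h0).le

theorem apply_ne_zero (h : IsTimeOriented B f) {u : E} (hu : B u u < 0) : f u ≠ 0 :=
  fun h0 => (h.nonneg_of_ker h0).not_gt hu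

/-- A timelike and a causal vector in the same half of the cone have negative product. -/
theorem neg_of_pos_of_pos (h : IsTimeOriented B f) {x y : E} (hx : B x x < 0) (hy : B y y ≤ 0)
    (fx : 0 < f x) (fy : 0 < f y) : B x y < 0 := by
  have h1 := h.nonneg_of_ker (u := f y • x - f x • y) (by simp [mul_comm])
  simp only [map_sub, map_smul, LinearMap.sub_apply, LinearMap.smul_apply, smul_eq_mul,
    h.symm y x] at h1
  by_contra! hn
  nlinarith [mul_pos fx fy, mul_nonneg (mul_pos fx fy).le hn, mul_pos fy fy, mul_pos fx fx,
    mul_nonneg (mul_pos fx fx).le (neg_nonneg.2 hy), mul_pos (mul_pos fy fy) (neg_pos.2 hx)]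

theorem pos_of_orthogonal (h : IsTimeOriented B f) {x u : E} (hx : B x x < 0) (hu : B x u = 0)
    (h0 : u ≠ 0) : 0 < B u u := by
  by_cases fu : f u = 0
  · exact h.pos_of_ker u fu h0
  have h1 := h.nonneg_of_ker (u := f u • x - f x • u) (by simp [mul_comm])
  have hu' : B u x = 0 := by rw [h.symm, hu]
  simp only [map_sub, map_smul, LinearMap.sub_apply, LinearMap.smul_apply, smul_eq_mul,
    hu, hu', mul_zero, sub_zero, zero_sub] at h1
  have h2 : 0 < f u * f u := mul_self_pos.2 fu
  have h3 : 0 < f x * f x := mul_self_pos.2 (h.apply_ne_zero hx)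
  by_contra! hn
  nlinarith [mul_pos h2 (neg_pos.2 hx), mul_nonneg h3.le (neg_nonneg.2 hn)]

/-- Two timelike vectors with negative product lie in the same half of the cone. -/
theorem pos_of_neg (h : IsTimeOriented B f) {x y : E} (hx : B x x < 0) (hy : B y y < 0)
    (fx : 0 < f x) (hxy : B x y < 0) : 0 < f y := by
  rcases lt_or_gt_of_ne (h.apply_ne_zero hy) with h1 | h1
  · have := h.neg_of_pos_of_pos (y := -y) hx (by simpa using hy.le) fx (by simpa using h1)
    simp only [map_neg] at this
    linarith
  · exact h1

theorem bReflection_bReflection (h : IsTimeOriented B f) {a : E} (ha : B a a ≠ 0) (u v : E) :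
    B (bReflection B a u) (bReflection B a v) = B u v := by
  simp only [bReflection_apply, map_sub, map_smul, LinearMap.sub_apply, LinearMap.smul_apply,
    smul_eq_mul, h.symm u a]
  field_simp
  ring

/-- A reflection in a spacelike vector preserves each half of the cone. -/
theorem bReflection_pos (h : IsTimeOriented B f) {a x : E} (ha : 0 < B a a) (hx : B x x < 0)
    (fx : 0 < f x) : 0 < f (bReflection B a x) := by
  refine h.pos_of_neg hx (by rwa [h.bReflection_bReflection ha.ne']) fx ?_
  simp only [bReflection_apply, map_sub, map_smul, smul_eq_mul, h.symm x a]
  have : 0 ≤ 2 * (B a x / B a a) * B a x := by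
    rw [show 2 * (B a x / B a a) * B a x = 2 * (B a x * B a x / B a a) by ring]
    have := mul_self_nonneg (B a x)
    positivity
  linarith

/-- Equality in the reversed Cauchy–Schwarz inequality on the chart `f = 1`. -/
theorem eq_of_mul_self_le (h : IsTimeOriented B f) {x y : E} (hx : B x x < 0) (fx : f x = 1)
    (fy : f y = 1) (hxy : B x y * B x y ≤ B x x * B y y) : x = y := by
  by_contra hne
  have hu := h.pos_of_ker (y - x) (by simp [fx, fy]) (sub_ne_zero.2 (Ne.symm hne))
  simp only [map_sub, LinearMap.sub_apply, h.symm y x] at hu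
  nlinarith [mul_pos (neg_pos.2 hx) hu, mul_self_nonneg (B x y - B x x)]

end IsTimeOriented

/-! ### The Hilbert metric in terms of the form -/

/-- The part of the chart `f = 1` on which `B` is negative. -/
def chartDomain {E : Type*} [AddCommGroup E] [Module ℝ E] (B : LinearMap.BilinForm ℝ E)
    (f : Module.Dual ℝ E) : Set E :=
  {v | f v = 1 ∧ B v v < 0}

/-- The part of the chart `f = 1` on which `B` vanishes. -/
def chartBoundary {E : Type*} [AddCommGroup E] [Module ℝ E] (B : LinearMap.BilinForm ℝ E)
    (f : Module.Dual ℝ E) : Set E :=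
  {v | f v = 1 ∧ B v v = 0}

/-- The action of a linear map on the chart `f = 1` (meaningful where `f (g v) ≠ 0`). -/
noncomputable def chartAction {E : Type*} [AddCommGroup E] [Module ℝ E] (f : Module.Dual ℝ E)
    (g : Module.End ℝ E) (v : E) : E :=
  (f (g v))⁻¹ • g v

section Hilbert

variable {E : Type*} [NormedAddCommGroup E] [NormedSpace ℝ E] {B : LinearMap.BilinForm ℝ E}
  {f : Module.Dual ℝ E}

/-- The cross ratio `R` on a chord with null endpoints is at least `1` and satisfies
`(R + 1)² / (4 R) = B(x, y)² / (B(x, x) B(y, y))`. -/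
theorem cosh_log_crossRatio (h : IsTimeOriented B f) {a b x y : E} (ha : B a a = 0)
    (hb : B b b = 0) (hx : B x x < 0) (hy : B y y < 0) (hxs : x ∈ segment ℝ a b)
    (hys : y ∈ segment ℝ x b) :
    0 ≤ Real.log (crossRatio a x y b) ∧
      Real.cosh (Real.log (crossRatio a x y b)) =
        2 * (B x y * B x y / (B x x * B y y)) - 1 := by
  obtain ⟨α, β, hα, hβ, hαβ, rfl⟩ := hxs
  obtain ⟨γ, δ, hγ, hδ, hγδ, rfl⟩ := hys
  have hne : a ≠ b := by
    rintro rfl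
    simp [ha] at hx
  have hN : 0 < ‖a - b‖ := norm_pos_iff.2 (sub_ne_zero.2 hne)
  have e1 : B (α • a + β • b) (α • a + β • b) = 2 * α * β * B a b := by
    simp [ha, hb, h.symm b a]; ring
  have e2 : B (α • a + β • b) (γ • (α • a + β • b) + δ • b) =
      α * (2 * γ * β + δ) * B a b := by
    simp [ha, hb, h.symm b a]; ring
  have e3 : B (γ • (α • a + β • b) + δ • b) (γ • (α • a + β • b) + δ • b) =
      2 * γ * α * (γ * β + δ) * B a b := by
    simp [ha, hb, h.symm b a]; ring
  rw [e1] at hx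
  rw [e3] at hy
  have α0 : α ≠ 0 := by rintro rfl; simp at hx
  have β0 : β ≠ 0 := by rintro rfl; simp at hx
  have γ0 : γ ≠ 0 := by rintro rfl; simp at hy
  have B0 : B a b ≠ 0 := by intro h0; simp [h0] at hx
  replace hα : 0 < α := lt_of_le_of_ne hα α0.symm
  replace hβ : 0 < β := lt_of_le_of_ne hβ β0.symm
  replace hγ : 0 < γ := lt_of_le_of_ne hγ γ0.symm
  obtain rfl : α = 1 - β := by linarith
  obtain rfl : γ = 1 - δ := by linarith
  have hs : 0 < (1 - δ) * β + δ := by positivity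
  have n1 : ‖(1 - δ) • ((1 - β) • a + β • b) + δ • b - a‖ = ((1 - δ) * β + δ) * ‖a - b‖ := by
    rw [show (1 - δ) • ((1 - β) • a + β • b) + δ • b - a
      = (-((1 - δ) * β + δ)) • (a - b) by module, norm_smul, Real.norm_eq_abs, abs_neg,
      abs_of_pos hs]
  have n2 : ‖(1 - β) • a + β • b - b‖ = (1 - β) * ‖a - b‖ := by
    rw [show (1 - β) • a + β • b - b = (1 - β) • (a - b) by module, norm_smul,
      Real.norm_eq_abs, abs_of_pos hα]
  have n3 : ‖(1 - δ) • ((1 - β) • a + β • b) + δ • b - b‖ = (1 - δ) * (1 - β) * ‖a - b‖ := by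
    rw [show (1 - δ) • ((1 - β) • a + β • b) + δ • b - b
      = ((1 - δ) * (1 - β)) • (a - b) by module, norm_smul,
      Real.norm_eq_abs, abs_of_pos (by positivity)]
  have n4 : ‖(1 - β) • a + β • b - a‖ = β * ‖a - b‖ := by
    rw [show (1 - β) • a + β • b - a = (-β) • (a - b) by module, norm_smul,
      Real.norm_eq_abs, abs_neg, abs_of_pos hβ]
  have hR : crossRatio a ((1 - β) • a + β • b) ((1 - δ) • ((1 - β) • a + β • b) + δ • b) b
      = ((1 - δ) * β + δ) / ((1 - δ) * β) := by
    rw [crossRatio, n1, n2, n3, n4]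
    field_simp
  rw [hR, e1, e2, e3]
  refine ⟨Real.log_nonneg ?_, ?_⟩
  · rw [le_div_iff₀ (by positivity)]
    linarith
  · rw [Real.cosh_log (by positivity)]
    generalize 1 - δ = γ at *
    field_simp
    ring

/-- The chord through two distinct points of the domain meets the boundary on both sides. -/
theorem exists_chord (h : IsTimeOriented B f) {x y : E} (hx : x ∈ chartDomain B f)
    (hy : y ∈ chartDomain B f) (hne : x ≠ y) :
    ∃ p : E × E, p.1 ∈ chartBoundary B f ∧ p.2 ∈ chartBoundary B f ∧
      x ∈ segment ℝ p.1 p.2 ∧ y ∈ segment ℝ x p.2 := by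
  obtain ⟨u, rfl⟩ : ∃ u, y = x + u := ⟨y - x, by simp⟩
  have fu : f u = 0 := by simpa [hx.1] using hy.1
  have hk : 0 < B u u := h.pos_of_ker u fu (by rintro rfl; simp at hne)
  have hq : B x x < 0 := hx.2
  have hy2 : B x x + 2 * B x u + B u u < 0 := by
    have := hy.2
    simp only [map_add, LinearMap.add_apply, h.symm u x] at this
    linarith
  set k := B u u
  set m := B x u
  set q := B x x
  set r := Real.sqrt (m * m - k * q)
  have hd : 0 < m * m - k * q := by nlinarith [mul_self_nonneg m, mul_pos hk (neg_pos.2 hq)]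
  have hr : r * r = m * m - k * q := Real.mul_self_sqrt hd.le
  have r0 : 0 < r := Real.sqrt_pos.2 hd
  -- `x + t u` is null exactly for `t = (-m ± r) / k`
  have hnull (t : ℝ) (ht : k * t * t + 2 * m * t + q = 0) : x + t • u ∈ chartBoundary B f := by
    refine ⟨by simp [fu, hx.1], ?_⟩
    simp only [map_add, map_smul, LinearMap.add_apply, LinearMap.smul_apply, smul_eq_mul,
      h.symm u x]
    linear_combination ht
  have hr1 : -m < r := by
    by_contra! hc
    nlinarith [mul_pos hk (neg_pos.2 hq)]
  have hr2 : m < r := by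
    by_contra! hc
    nlinarith [mul_pos hk (neg_pos.2 hq)]
  have hr3 : m + k < r := by
    by_contra! hc
    nlinarith
  have ht1 : 0 < (m + r) / k := div_pos (by linarith) hk
  have ht2 : 1 < (r - m) / k := by
    rw [lt_div_iff₀ hk]
    linarith
  have hz1 : k * (-((m + r) / k)) * (-((m + r) / k)) + 2 * m * (-((m + r) / k)) + q = 0 := by
    field_simp
    linear_combination hr
  have hz2 : k * ((r - m) / k) * ((r - m) / k) + 2 * m * ((r - m) / k) + q = 0 := by
    field_simp
    linear_combination hr
  generalize (m + r) / k = s at *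
  generalize (r - m) / k = t at *
  refine ⟨(x + (-s) • u, x + t • u), hnull _ hz1, hnull _ hz2, ?_, ?_⟩
  · refine ⟨t / (s + t), s / (s + t), by positivity, by positivity, by field_simp; ring, ?_⟩
    match_scalars <;> field_simp <;> ring
  · refine ⟨1 - 1 / t, 1 / t, ?_, by positivity, by ring, ?_⟩
    · rw [sub_nonneg, div_le_one (by linarith)]
      exact ht2.le
    · match_scalars <;> field_simp; ring

/-- The Hilbert distance of the quadric is determined by the form, as in the Klein model of
hyperbolic space. -/
theorem cosh_hilbertDist (h : IsTimeOriented B f) {x y : E} (hx : x ∈ chartDomain B f)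
    (hy : y ∈ chartDomain B f) :
    0 ≤ hilbertDist (chartBoundary B f) x y ∧
      Real.cosh (hilbertDist (chartBoundary B f) x y) =
        2 * (B x y * B x y / (B x x * B y y)) - 1 := by
  unfold hilbertDist
  split_ifs with hp
  · obtain ⟨h1, h2, h3, h4⟩ := hp.choose_spec
    exact cosh_log_crossRatio h h1.2 h2.2 hx.2 hy.2 h3 h4
  · obtain rfl : x = y := by
      by_contra hne
      exact hp (exists_chord h hx hy hne)
    have := hx.2.ne
    refine ⟨le_rfl, ?_⟩
    rw [div_self (mul_ne_zero this this)]
    norm_num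

theorem hilbertDist_eq_of_eq (h : IsTimeOriented B f) {x y x' y' : E} (hx : x ∈ chartDomain B f)
    (hy : y ∈ chartDomain B f) (hx' : x' ∈ chartDomain B f) (hy' : y' ∈ chartDomain B f)
    (he : B x y * B x y / (B x x * B y y) = B x' y' * B x' y' / (B x' x' * B y' y')) :
    hilbertDist (chartBoundary B f) x y = hilbertDist (chartBoundary B f) x' y' := by
  obtain ⟨h1, h2⟩ := cosh_hilbertDist h hx hy
  obtain ⟨h3, h4⟩ := cosh_hilbertDist h hx' hy'
  refine Real.cosh_strictMonoOn.injOn h1 h3 ?_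
  rw [h2, h4, he]

theorem hilbertDist_lt_of_lt (h : IsTimeOriented B f) {x y x' y' : E} (hx : x ∈ chartDomain B f)
    (hy : y ∈ chartDomain B f) (hx' : x' ∈ chartDomain B f) (hy' : y' ∈ chartDomain B f)
    (he : B x y * B x y / (B x x * B y y) < B x' y' * B x' y' / (B x' x' * B y' y')) :
    hilbertDist (chartBoundary B f) x y < hilbertDist (chartBoundary B f) x' y' := by
  obtain ⟨h1, h2⟩ := cosh_hilbertDist h hx hy
  obtain ⟨h3, h4⟩ := cosh_hilbertDist h hx' hy'
  refine (Real.cosh_strictMonoOn.lt_iff_lt h1 h3).1 ?_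
  rw [h2, h4]
  linarith

end Hilbert

/-! ### Isometries fixing a null vector -/

section Parabolic

variable {E : Type*} [NormedAddCommGroup E] [NormedSpace ℝ E] {B : LinearMap.BilinForm ℝ E}
  {f : Module.Dual ℝ E}

/-- `g` preserves `B` and each half of its cone. -/
structure PreservesCone (B : LinearMap.BilinForm ℝ E) (f : Module.Dual ℝ E)
    (g : Module.End ℝ E) : Prop where
  form : ∀ u v, B (g u) (g v) = B u v
  pos : ∀ x, B x x < 0 → 0 < f x → 0 < f (g x)

variable {g g' : Module.End ℝ E}

theorem PreservesCone.pos_of_mem (hg : PreservesCone B f g) {x : E} (hx : x ∈ chartDomain B f) :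
    0 < f (g x) :=
  hg.pos x hx.2 (by rw [hx.1]; exact one_pos)

theorem PreservesCone.mapsTo (hg : PreservesCone B f g) :
    Set.MapsTo (chartAction f g) (chartDomain B f) (chartDomain B f) := by
  intro x hx
  have h0 := hg.pos_of_mem hx
  refine ⟨by simp [chartAction, h0.ne'], ?_⟩
  simp only [chartAction, map_smul, LinearMap.smul_apply, smul_eq_mul, hg.form]
  have := hx.2
  have : 0 < (f (g x))⁻¹ := by positivity
  exact mul_neg_of_pos_of_neg this (mul_neg_of_pos_of_neg this hx.2)

theorem PreservesCone.chartAction_chartAction (hg : PreservesCone B f g)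
    (hinv : ∀ v, g' (g v) = v) {x : E} (hx : x ∈ chartDomain B f) :
    chartAction f g' (chartAction f g x) = x := by
  have h0 := (hg.pos_of_mem hx).ne'
  simp [chartAction, hinv, hx.1, h0]

theorem PreservesCone.isIsometryOf (h : IsTimeOriented B f) (hg : PreservesCone B f g)
    (hg' : PreservesCone B f g') (h1 : ∀ v, g' (g v) = v) (h2 : ∀ v, g (g' v) = v) :
    IsIsometryOf (chartDomain B f) (hilbertDist (chartBoundary B f)) (chartAction f g) := by
  refine ⟨Set.InvOn.bijOn (f' := chartAction f g')
    ⟨fun x hx => hg.chartAction_chartAction h1 hx, fun x hx => hg'.chartAction_chartAction h2 hx⟩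
    hg.mapsTo hg'.mapsTo, fun x hx y hy => ?_⟩
  refine hilbertDist_eq_of_eq h (hg.mapsTo hx) (hg.mapsTo hy) hx hy ?_
  have := (hg.pos_of_mem hx).ne'
  have := (hg.pos_of_mem hy).ne'
  have := hx.2.ne
  have := hy.2.ne
  simp only [chartAction, map_smul, LinearMap.smul_apply, smul_eq_mul, hg.form]
  field_simp

/-- A fixed point of the action inside the domain is fixed by the linear map itself. -/
theorem PreservesCone.apply_eq_of_chartAction_eq (hg : PreservesCone B f g) {x : E}
    (hx : x ∈ chartDomain B f) (he : chartAction f g x = x) : g x = x := by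
  have h0 := hg.pos_of_mem hx
  have he' : g x = f (g x) • x := (inv_smul_eq_iff₀ h0.ne').1 he
  have h1 := hg.form x x
  rw [he'] at h1
  simp only [map_smul, LinearMap.smul_apply, smul_eq_mul] at h1
  have h2 : f (g x) = 1 := by
    have : (f (g x) - 1) * (f (g x) + 1) = 0 := by
      apply mul_right_cancel₀ hx.2.ne
      linear_combination h1
    rcases mul_eq_zero.1 this with h | h <;> linarith
  rw [he', h2, one_smul]

/-- A cone-preserving map fixing a null vector `ξ`, but no vector of the domain, fixes no other
boundary point: the midpoint of two fixed boundary points would be a fixed point inside. -/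
theorem PreservesCone.eq_of_chartAction_eq (h : IsTimeOriented B f) (hg : PreservesCone B f g)
    {ξ η : E} (hξ : ξ ∈ chartBoundary B f) (hgξ : g ξ = ξ)
    (hfix : ∀ x ∈ chartDomain B f, g x ≠ x) (hη : η ∈ chartBoundary B f)
    (he : chartAction f g η = η) : η = ξ := by
  by_contra hne
  have h0 : f (g η) ≠ 0 := by
    intro h0
    have := hη.1
    rw [← he] at this
    simp [chartAction, h0] at this
  have he' : g η = f (g η) • η := (inv_smul_eq_iff₀ h0).1 he
  have hneg : B ξ η < 0 := by
    have := h.pos_of_ker (η - ξ) (by simp [hη.1, hξ.1]) (sub_ne_zero.2 hne)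
    simp only [map_sub, LinearMap.sub_apply, h.symm η ξ, hη.2, hξ.2] at this
    linarith
  have h1 := hg.form ξ η
  rw [hgξ, he', map_smul, smul_eq_mul] at h1
  have h2 : f (g η) = 1 := mul_right_cancel₀ hneg.ne (h1.trans (one_mul _).symm)
  refine hfix ((1 / 2 : ℝ) • (ξ + η)) ⟨?_, ?_⟩ ?_
  · simp [hξ.1, hη.1]
    norm_num
  · simp only [map_add, map_smul, LinearMap.add_apply, LinearMap.smul_apply, smul_eq_mul,
      h.symm η ξ, hη.2, hξ.2]
    linarith
  · rw [map_smul, map_add, hgξ, he', h2, one_smul]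

/-- A cone-preserving map fixing a null vector `ξ`, but no vector of the domain, is parabolic:
moving a point `x` towards `ξ` strictly decreases its displacement, because `B(x, g x)` and
`B(x, x)` change by the same negative amount. -/
theorem PreservesCone.isParabolicIsometryOf (h : IsTimeOriented B f) (hg : PreservesCone B f g)
    (hg' : PreservesCone B f g') (h1 : ∀ v, g' (g v) = v) (h2 : ∀ v, g (g' v) = v)
    {ξ : E} (hξ : ξ ∈ chartBoundary B f) (hgξ : g ξ = ξ)
    (hfix : ∀ x ∈ chartDomain B f, g x ≠ x) :
    IsParabolicIsometryOf (chartDomain B f) (hilbertDist (chartBoundary B f))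
      (chartAction f g) := by
  have hiso := hg.isIsometryOf h hg' h1 h2
  refine ⟨hiso, ?_⟩
  rintro ⟨x, hx, hmin⟩
  set d := hilbertDist (chartBoundary B f)
  have hr : B x ξ < 0 :=
    h.neg_of_pos_of_pos hx.2 hξ.2.le (by rw [hx.1]; exact one_pos) (by rw [hξ.1]; exact one_pos)
  have hq : B x x < 0 := hx.2
  have hgr : B (g x) ξ = B x ξ := by
    conv_lhs => rw [← hgξ]
    exact hg.form x ξ
  have hp : B x (g x) < 0 :=
    h.neg_of_pos_of_pos hx.2 (by rw [hg.form]; exact hq.le) (by rw [hx.1]; exact one_pos)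
      (hg.pos_of_mem hx)
  have hgx := hg.mapsTo hx
  have hpq : B x (g x) < B x x := by
    by_contra! hc
    refine hfix x hx (hg.apply_eq_of_chartAction_eq hx ?_)
    refine (h.eq_of_mul_self_le hq hx.1 hgx.1 ?_).symm
    have h0 : 0 < (f (g x))⁻¹ := inv_pos.2 (hg.pos_of_mem hx)
    simp only [chartAction, map_smul, LinearMap.smul_apply, smul_eq_mul, hg.form]
    have : B x (g x) * B x (g x) ≤ B x x * B x x := by nlinarith
    nlinarith [mul_le_mul_of_nonneg_left this (mul_pos h0 h0).le]
  -- the midpoint of `x` and `ξ` is displaced less than `x`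
  set y := (1 / 2 : ℝ) • (x + ξ)
  have hgy : g y = (1 / 2 : ℝ) • (g x + ξ) := by rw [map_smul, map_add, hgξ]
  have eyy : B y y = (B x x + 2 * B x ξ) / 4 := by
    simp only [y, map_add, map_smul, LinearMap.add_apply, LinearMap.smul_apply, smul_eq_mul,
      h.symm ξ x, hξ.2]
    ring
  have eyg : B y (g y) = (B x (g x) + 2 * B x ξ) / 4 := by
    rw [hgy]
    simp only [y, map_add, map_smul, LinearMap.add_apply, LinearMap.smul_apply, smul_eq_mul,
      h.symm ξ (g x), hgr, hξ.2]
    ring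
  have hy : y ∈ chartDomain B f := by
    refine ⟨?_, by rw [eyy]; linarith⟩
    simp [y, hx.1, hξ.1]
    norm_num
  have ratio (z : E) (hz : z ∈ chartDomain B f) :
      B z (chartAction f g z) * B z (chartAction f g z) /
        (B z z * B (chartAction f g z) (chartAction f g z)) =
      (B z (g z) / B z z) ^ 2 := by
    have := (hg.pos_of_mem hz).ne'
    have := hz.2.ne
    simp only [chartAction, map_smul, LinearMap.smul_apply, smul_eq_mul, hg.form]
    field_simp
  have hlt : d y (chartAction f g y) < d x (chartAction f g x) := by
    refine hilbertDist_lt_of_lt h hy (hg.mapsTo hy) hx hgx ?_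
    rw [ratio y hy, ratio x hx, eyy, eyg]
    have e0 : (B x (g x) + 2 * B x ξ) / 4 / ((B x x + 2 * B x ξ) / 4) < B x (g x) / B x x := by
      rw [div_div_div_cancel_right₀ (by norm_num), ← neg_div_neg_eq (_ + _),
        ← neg_div_neg_eq (B x (g x)), div_lt_div_iff₀ (by linarith) (by linarith)]
      nlinarith
    refine pow_lt_pow_left₀ e0 ?_ two_ne_zero
    exact div_nonneg_of_nonpos (by linarith) (by linarith)
  have hbdd : BddBelow ((fun x => d x (chartAction f g x)) '' chartDomain B f) :=
    ⟨0, by rintro _ ⟨z, hz, rfl⟩; exact (cosh_hilbertDist h hz (hg.mapsTo hz)).1⟩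
  have hle : translationLength (chartDomain B f) d (chartAction f g) ≤ d y (chartAction f g y) :=
    csInf_le hbdd ⟨y, hy, rfl⟩
  linarith

end Parabolic

/-! ### Positivity of roots and descents -/

section Roots

variable {ι : Type*} {M : CoxeterMatrix ι} {W : Type*} [Group W] (cs : CoxeterSystem M W)
  {A : Matrix ι ι ℝ}

theorem IsCoxeterGram.apply_self (hA : IsCoxeterGram M A) (i : ι) : A i i = 1 := by
  rw [hA.finite_label i i (by simp)]
  simp

theorem IsCoxeterGram.nonpos (hA : IsCoxeterGram M A) {i j : ι} (hij : i ≠ j) : A i j ≤ 0 := by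
  by_cases h0 : M i j = 0
  · linarith [hA.infinite_label i j h0]
  · have h1 := M.off_diagonal i j hij
    have h2 : (2 : ℝ) ≤ M i j := by exact_mod_cast (by lia : 2 ≤ M i j)
    rw [hA.finite_label i j h0, neg_nonpos]
    refine Real.cos_nonneg_of_neg_pi_div_two_le_of_le ?_ ?_
    · have := Real.pi_pos
      have : 0 < π / (M i j : ℝ) := by positivity
      linarith
    · exact div_le_div_of_nonneg_left Real.pi_pos.le two_pos h2

/-- The coefficients `0, 1, 2c, 4c² - 1, …` of the roots in a rank two subsystem whose simple roots
have product `-c`; for `c = cos θ` they are `sin (k θ) / sin θ`. -/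
def dihedralCoeff (c : ℝ) : ℕ → ℝ
  | 0 => 0
  | 1 => 1
  | k + 2 => 2 * c * dihedralCoeff c (k + 1) - dihedralCoeff c k

theorem dihedralCoeff_mul_sin (θ : ℝ) :
    ∀ k : ℕ, dihedralCoeff (Real.cos θ) k * Real.sin θ = Real.sin (k * θ)
  | 0 => by simp [dihedralCoeff]
  | 1 => by simp [dihedralCoeff]
  | k + 2 => by
    have h1 := dihedralCoeff_mul_sin θ (k + 1)
    have h2 := dihedralCoeff_mul_sin θ k
    have e1 : (((k + 2 : ℕ) : ℝ)) * θ = ((k + 1 : ℕ) : ℝ) * θ + θ := by push_cast; ring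
    have e2 : (k : ℝ) * θ = ((k + 1 : ℕ) : ℝ) * θ - θ := by push_cast; ring
    rw [e2, Real.sin_sub] at h2
    rw [e1, Real.sin_add, dihedralCoeff]
    linear_combination 2 * Real.cos θ * h1 - h2

theorem dihedralCoeff_monotone {c : ℝ} (hc : 1 ≤ c) (k : ℕ) :
    0 ≤ dihedralCoeff c k ∧ dihedralCoeff c k ≤ dihedralCoeff c (k + 1) := by
  induction k with
  | zero => simp [dihedralCoeff]
  | succ k ih =>
    refine ⟨ih.1.trans ih.2, ?_⟩
    rw [dihedralCoeff]
    nlinarith [mul_nonneg (sub_nonneg.2 hc) (ih.1.trans ih.2)]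

theorem dihedralCoeff_nonneg (hA : IsCoxeterGram M A) {i j : ι} (hij : i ≠ j) {k : ℕ}
    (hk : M i j ≠ 0 → k ≤ M i j) : 0 ≤ dihedralCoeff (-A i j) k := by
  by_cases h0 : M i j = 0
  · exact (dihedralCoeff_monotone (by linarith [hA.infinite_label i j h0]) k).1
  · have h1 := M.off_diagonal i j hij
    have h2 : (2 : ℝ) ≤ M i j := by exact_mod_cast (by lia : 2 ≤ M i j)
    have hk' : (k : ℝ) ≤ M i j := by exact_mod_cast hk h0
    rw [hA.finite_label i j h0, neg_neg]
    have hpos : 0 < Real.sin (π / M i j) := by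
      refine Real.sin_pos_of_pos_of_lt_pi (by positivity) ?_
      rw [div_lt_iff₀ (by positivity)]
      nlinarith [Real.pi_pos]
    refine nonneg_of_mul_nonneg_left ?_ hpos
    rw [dihedralCoeff_mul_sin]
    refine Real.sin_nonneg_of_nonneg_of_le_pi (by positivity) ?_
    rw [← mul_div_assoc, div_le_iff₀ (by positivity)]
    nlinarith [Real.pi_pos]

/-- If `w` has the right descent `j`, then it is a reduced product of some `v` having neither `i`
nor `j` as right descent and an alternating word in `i, j` ending in `j`. -/
theorem exists_alternatingWord_suffix {w : W} {j : ι} (i : ι)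
    (hj : cs.IsRightDescent w j) :
    ∃ (v : W) (k : ℕ), 0 < k ∧ w = v * cs.wordProd (CoxeterSystem.alternatingWord i j k) ∧
      cs.length v + k = cs.length w ∧ ¬ cs.IsRightDescent v i ∧ ¬ cs.IsRightDescent v j := by
  classical
  let P (k : ℕ) : Prop := ∃ v : W, w = v * cs.wordProd (CoxeterSystem.alternatingWord i j k) ∧
    cs.length v + k = cs.length w
  have hP1 : P 1 := by
    refine ⟨w * cs.simple j, ?_, ?_⟩
    · simp [CoxeterSystem.alternatingWord]
    · exact cs.isRightDescent_iff.1 hj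
  have hle : 1 ≤ cs.length w := by
    have := cs.isRightDescent_iff.1 hj
    lia
  have hb : ∀ k, P k → k ≤ cs.length w := fun k ⟨v, _, hv⟩ => by lia
  set k := Nat.findGreatest P (cs.length w)
  have hk1 : 1 ≤ k := Nat.le_findGreatest hle hP1
  obtain ⟨v, hv, hl⟩ : P k := Nat.findGreatest_spec hle hP1
  have hmax : ¬ P (k + 1) := fun h => by
    have := Nat.le_findGreatest (hb _ h) h
    lia
  -- the letter that would extend the alternating word is not a descent of `v`, by maximality
  have hext : ¬ cs.IsRightDescent v (if Even k then j else i) := by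
    intro hd
    refine hmax ⟨v * cs.simple (if Even k then j else i), ?_, ?_⟩
    · rw [CoxeterSystem.alternatingWord_succ', CoxeterSystem.wordProd_cons, hv]
      simp [mul_assoc]
    · have := cs.isRightDescent_iff.1 hd
      lia
  -- the first letter of the alternating word is not a descent of `v`, by reducedness
  have hfirst : ¬ cs.IsRightDescent v (if Even k then i else j) := by
    intro hd
    obtain ⟨l, hkl⟩ : ∃ l, k = l + 1 := ⟨k - 1, by lia⟩
    have hlet : (if Even l then j else i) = (if Even k then i else j) := by
      by_cases h : Even l <;> simp [hkl, h, Nat.even_add_one]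
    have hw : w = (v * cs.simple (if Even k then i else j)) *
        cs.wordProd (CoxeterSystem.alternatingWord i j l) := by
      conv_lhs => rw [hv, hkl]
      rw [CoxeterSystem.alternatingWord_succ', CoxeterSystem.wordProd_cons, hlet, mul_assoc]
    have h1 := cs.length_mul_le (v * cs.simple (if Even k then i else j))
      (cs.wordProd (CoxeterSystem.alternatingWord i j l))
    rw [← hw] at h1
    have h2 := cs.length_wordProd_le (CoxeterSystem.alternatingWord i j l)
    rw [CoxeterSystem.length_alternatingWord] at h2
    have h3 := cs.isRightDescent_iff.1 hd
    lia
  refine ⟨v, k, hk1, hv, hl, ?_⟩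
  by_cases h : Even k
  · rw [if_pos h] at hext hfirst
    exact ⟨hfirst, hext⟩
  · rw [if_neg h] at hext hfirst
    exact ⟨hext, hfirst⟩

/-- An alternating suffix is shorter than the order of the product of its letters, unless the
other letter is a descent as well. -/
theorem lt_of_alternatingWord_suffix {v w : W} {i j : ι} {k : ℕ}
    (hw : w = v * cs.wordProd (CoxeterSystem.alternatingWord i j k))
    (hl : cs.length v + k = cs.length w) (hi : ¬ cs.IsRightDescent w i) (h0 : M i j ≠ 0) :
    k < M i j := by
  by_contra! hc
  obtain ⟨u, hu⟩ : ∃ u : List ι, CoxeterSystem.alternatingWord i j k =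
      u ++ CoxeterSystem.alternatingWord i j (M i j) := by
    obtain ⟨d, rfl⟩ := Nat.exists_eq_add_of_le hc
    clear hw hl hc
    induction d with
    | zero => exact ⟨[], rfl⟩
    | succ d ih =>
      obtain ⟨u, hu⟩ := ih
      rw [← add_assoc, CoxeterSystem.alternatingWord_succ', hu]
      exact ⟨_ :: u, rfl⟩
  have hlen := congrArg List.length hu
  rw [List.length_append, CoxeterSystem.length_alternatingWord,
    CoxeterSystem.length_alternatingWord] at hlen
  obtain ⟨m, hm⟩ : ∃ m, M i j = m + 1 := ⟨M i j - 1, by lia⟩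
  have hbr := cs.wordProd_braidWord_eq i j
  rw [CoxeterSystem.braidWord, CoxeterSystem.braidWord, M.symmetric j i, hm] at hbr
  have hw' : w * cs.simple i =
      v * cs.wordProd u * cs.wordProd (CoxeterSystem.alternatingWord i j m) := by
    rw [hw, hu, CoxeterSystem.wordProd_append, hm, hbr, CoxeterSystem.alternatingWord_succ,
      CoxeterSystem.wordProd_concat]
    simp [mul_assoc]
  apply hi
  rw [CoxeterSystem.IsRightDescent, hw']
  have h1 := cs.length_mul_le (v * cs.wordProd u)
    (cs.wordProd (CoxeterSystem.alternatingWord i j m))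
  have h2 := cs.length_mul_le v (cs.wordProd u)
  have h3 := cs.length_wordProd_le u
  have h4 := cs.length_wordProd_le (CoxeterSystem.alternatingWord i j m)
  rw [CoxeterSystem.length_alternatingWord] at h4
  lia

variable [Fintype ι] [DecidableEq ι] (hA : IsCoxeterGram M A)

theorem linearAction_simple_root (i j : ι) :
    linearAction cs hA (cs.simple i) (simpleRoot j) =
      simpleRoot j - (2 * A i j) • simpleRoot i := by
  rw [linearAction_simple, bReflection_apply, gramForm_simpleRoot, gramForm_simpleRoot,
    hA.apply_self, div_one]

theorem linearAction_alternatingWord (i j : ι) (k : ℕ) :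
    linearAction cs hA (cs.wordProd (CoxeterSystem.alternatingWord i j k)) (simpleRoot i) =
      if Even k then
        dihedralCoeff (-A i j) (k + 1) • simpleRoot i + dihedralCoeff (-A i j) k • simpleRoot j
      else
        dihedralCoeff (-A i j) k • simpleRoot i +
          dihedralCoeff (-A i j) (k + 1) • simpleRoot j := by
  have hs : A j i = A i j := hA.symm.apply i j
  induction k with
  | zero => simp [CoxeterSystem.alternatingWord, dihedralCoeff]
  | succ k ih =>
    rw [CoxeterSystem.alternatingWord_succ', CoxeterSystem.wordProd_cons, map_mul,
      Module.End.mul_apply, ih]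
    by_cases hk : Even k
    · rw [if_pos hk, if_pos hk, if_neg (by simpa [Nat.even_add_one] using hk)]
      simp only [map_add, map_smul, linearAction_simple_root, hA.apply_self, hs, dihedralCoeff]
      module
    · rw [if_neg hk, if_neg hk, if_pos (by simpa [Nat.even_add_one] using hk)]
      simp only [map_add, map_smul, linearAction_simple_root, hA.apply_self, dihedralCoeff]
      module

/-- If `i` is not a right descent of `w`, then `w` maps the simple root `α_i` to a nonnegative
combination of simple roots. -/
theorem linearAction_simpleRoot_nonneg (w : W) (i : ι) (hi : ¬ cs.IsRightDescent w i) (l : ι) :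
    0 ≤ linearAction cs hA w (simpleRoot i) l := by
  induction hn : cs.length w using Nat.strong_induction_on generalizing w i with
  | _ n ih =>
    by_cases hw1 : w = 1
    · subst hw1
      simp only [map_one, Module.End.one_apply, simpleRoot, EuclideanSpace.basisFun_apply,
        PiLp.single_apply]
      split_ifs <;> norm_num
    obtain ⟨j, hj⟩ := cs.exists_rightDescent_of_ne_one hw1
    have hij : i ≠ j := by
      rintro rfl
      exact hi hj
    obtain ⟨v, k, hk, hv, hl, hvi, hvj⟩ := exists_alternatingWord_suffix cs i hj
    have hlt : M i j ≠ 0 → k < M i j := lt_of_alternatingWord_suffix cs hv hl hi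
    have pi := ih (cs.length v) (by lia) v i hvi rfl
    have pj := ih (cs.length v) (by lia) v j hvj rfl
    have c0 := dihedralCoeff_nonneg hA hij (k := k) fun h => (hlt h).le
    have c1 := dihedralCoeff_nonneg hA hij (k := k + 1) fun h => hlt h
    rw [hv, map_mul, Module.End.mul_apply, linearAction_alternatingWord]
    split_ifs <;>
    · simp only [map_add, map_smul, PiLp.add_apply, PiLp.smul_apply, smul_eq_mul]
      positivity

/-- A nontrivial element moves some simple root far from itself: the corresponding coordinate
becomes nonpositive. This contains the faithfulness and the discreteness of the action. -/
theorem exists_linearAction_simpleRoot_nonpos {w : W} (hw : w ≠ 1) :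
    ∃ i, linearAction cs hA w (simpleRoot i) i ≤ 0 := by
  obtain ⟨i, hi⟩ := cs.exists_rightDescent_of_ne_one hw
  refine ⟨i, ?_⟩
  have h := linearAction_simpleRoot_nonneg cs hA (w * cs.simple i) i
    (cs.isRightDescent_iff_not_isRightDescent_mul.1 hi) i
  rw [map_mul, Module.End.mul_apply, linearAction_simple_root, hA.apply_self] at h
  have e : simpleRoot i - (2 * 1 : ℝ) • simpleRoot i = -simpleRoot i := by module
  rw [e, map_neg, PiLp.neg_apply] at h
  linarith

end Roots

/-! ### Gram matrices, their signature and the Perron–Frobenius eigenvector -/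

section Gram

variable {ι : Type*} [Fintype ι] [DecidableEq ι] {A : Matrix ι ι ℝ}

theorem gramForm_apply (A : Matrix ι ι ℝ) (u v : EuclideanSpace ℝ ι) :
    gramForm A u v = ∑ i, ∑ j, u i * A i j * v j := by
  simp [gramForm, Matrix.toBilin_apply]

theorem gramForm_simpleRoot_left (A : Matrix ι ι ℝ) (i : ι) (v : EuclideanSpace ℝ ι) :
    gramForm A (simpleRoot i) v = ∑ j, A i j * v j := by
  rw [gramForm_apply, Finset.sum_eq_single i]
  · simp [simpleRoot]
  · intro j _ hj
    simp [simpleRoot, hj]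
  · simp

theorem gramForm_eq_sum_left (A : Matrix ι ι ℝ) (u v : EuclideanSpace ℝ ι) :
    gramForm A u v = ∑ i, u i * gramForm A (simpleRoot i) v := by
  rw [gramForm_apply]
  simp only [gramForm_simpleRoot_left, Finset.mul_sum, mul_assoc]

theorem gramForm_comm (hA : A.IsSymm) (u v : EuclideanSpace ℝ ι) :
    gramForm A u v = gramForm A v u := by
  rw [gramForm_apply, gramForm_apply, Finset.sum_comm]
  refine Finset.sum_congr rfl fun i _ => Finset.sum_congr rfl fun j _ => ?_
  rw [hA.apply]
  ring

theorem continuous_gramForm_right (A : Matrix ι ι ℝ) (u : EuclideanSpace ℝ ι) :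
    Continuous fun v => gramForm A u v := by
  simp only [gramForm_apply]
  fun_prop

theorem continuous_gramForm_self (A : Matrix ι ι ℝ) : Continuous fun v => gramForm A v v := by
  simp only [gramForm_apply]
  fun_prop

/-- An isotropic vector of a positive semidefinite form lies in its radical. -/
theorem gramForm_simpleRoot_eq_zero (hA : A.IsSymm) (hpos : ∀ u, 0 ≤ gramForm A u u)
    {v : EuclideanSpace ℝ ι} (hv : gramForm A v v = 0) (i : ι) :
    gramForm A (simpleRoot i) v = 0 := by
  have h := LinearMap.BilinForm.apply_mul_apply_le_of_forall_zero_le (gramForm A) hpos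
    (simpleRoot i) v
  rw [hv, mul_zero, gramForm_comm hA v] at h
  exact mul_self_eq_zero.1 (le_antisymm h (mul_self_nonneg _))

theorem gramForm_sub_smul_one (A : Matrix ι ι ℝ) (μ : ℝ) (u v : EuclideanSpace ℝ ι) :
    gramForm (A - μ • 1) u v = gramForm A u v - μ * ∑ i, u i * v i := by
  have h (i : ι) : gramForm (A - μ • 1) (simpleRoot i) v =
      gramForm A (simpleRoot i) v - μ * v i := by
    simp [gramForm_simpleRoot_left, Matrix.one_apply, sub_mul, Finset.sum_sub_distrib]
  rw [gramForm_eq_sum_left, gramForm_eq_sum_left A, Finset.mul_sum, ← Finset.sum_sub_distrib]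
  refine Finset.sum_congr rfl fun i _ => ?_
  rw [h]
  ring

/-- Replacing a vector by its coordinatewise absolute value does not increase the form, if the
off-diagonal entries of the Gram matrix are nonpositive. -/
theorem gramForm_abs_le (hoff : ∀ i j, i ≠ j → A i j ≤ 0) (v : EuclideanSpace ℝ ι) :
    gramForm A (WithLp.toLp 2 fun i => |v i|) (WithLp.toLp 2 fun i => |v i|) ≤
      gramForm A v v := by
  rw [gramForm_apply, gramForm_apply]
  refine Finset.sum_le_sum fun i _ => Finset.sum_le_sum fun j _ => ?_
  by_cases hij : i = j
  · subst hij
    have := abs_mul_abs_self (v i)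
    exact le_of_eq (by linear_combination A i i * this)
  · have h1 : v i * v j ≤ |v i| * |v j| := by
      rw [← abs_mul]
      exact le_abs_self _
    have := mul_le_mul_of_nonpos_left h1 (hoff i j hij)
    show |v i| * A i j * |v j| ≤ v i * A i j * v j
    linarith

/-- Perron–Frobenius for a symmetric matrix with nonpositive off-diagonal entries: a minimizer of
the form on the unit sphere can be chosen with nonnegative coordinates, it is an eigenvector, and
by irreducibility none of its coordinates vanishes. -/
theorem exists_isNormalizedEigenvector (hA : A.IsSymm) (hoff : ∀ i j, i ≠ j → A i j ≤ 0)
    (hneg : ∃ v, gramForm A v v < 0) (hirr : IsIrreducibleGram A) :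
    ∃ o, IsNormalizedEigenvector A o := by
  obtain ⟨v₀, hv₀⟩ := hneg
  have hnv₀ : 0 < ‖v₀‖ := norm_pos_iff.2 (by rintro rfl; simp at hv₀)
  have hscale (v : EuclideanSpace ℝ ι) (c : ℝ) :
      gramForm A (c • v) (c • v) = c ^ 2 * gramForm A v v := by
    simp only [map_smul, LinearMap.smul_apply, smul_eq_mul]
    ring
  have hmem {v : EuclideanSpace ℝ ι} (hv : 0 < ‖v‖) : ‖v‖⁻¹ • v ∈ Metric.sphere 0 1 := by
    simp [norm_smul, hv.ne']
  obtain ⟨v, hv, hmin⟩ := (isCompact_sphere (0 : EuclideanSpace ℝ ι) 1).exists_isMinOn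
    ⟨_, hmem hnv₀⟩ (continuous_gramForm_self A).continuousOn
  set o : EuclideanSpace ℝ ι := WithLp.toLp 2 fun i => |v i| with ho
  have hsq (u : EuclideanSpace ℝ ι) : ‖u‖ ^ 2 = ∑ i, u i * u i := by
    rw [EuclideanSpace.norm_sq_eq]
    exact Finset.sum_congr rfl fun i _ => by rw [Real.norm_eq_abs, sq_abs, sq]
  have hvn : ‖v‖ = 1 := by simpa using hv
  have hon : ‖o‖ = 1 := by
    have : ‖o‖ ^ 2 = ‖v‖ ^ 2 := by
      rw [hsq, hsq]
      exact Finset.sum_congr rfl fun i _ => abs_mul_abs_self (v i)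
    rw [hvn] at this
    exact (pow_eq_one_iff_of_nonneg (norm_nonneg _) two_ne_zero).1 (by simpa using this)
  set μ := gramForm A o o with hμ
  have hle (u : EuclideanSpace ℝ ι) : μ * ‖u‖ ^ 2 ≤ gramForm A u u := by
    rcases eq_or_lt_of_le (norm_nonneg u) with h0 | h0
    · simp [norm_eq_zero.1 h0.symm]
    · have h1 := (gramForm_abs_le hoff v).trans (hmin (hmem h0))
      simp only [hscale] at h1
      rw [inv_pow, ← div_eq_inv_mul] at h1
      exact (le_div_iff₀ (by positivity)).1 h1
  have hμ0 : μ < 0 := by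
    by_contra! hc
    have := hle v₀
    have : 0 ≤ μ * ‖v₀‖ ^ 2 := by positivity
    linarith
  have heig (i : ι) : ∑ j, A i j * o j = μ * o i := by
    have h1 := gramForm_simpleRoot_eq_zero (A := A - μ • 1) (hA.sub (Matrix.isSymm_one.smul μ))
      (fun u => by rw [gramForm_sub_smul_one, ← hsq]; linarith [hle u]) (v := o)
      (by rw [gramForm_sub_smul_one, ← hsq, hon]; linarith) i
    rw [gramForm_sub_smul_one, gramForm_simpleRoot_left] at h1
    have h2 : ∑ j, (simpleRoot i : EuclideanSpace ℝ ι) j * o j = o i := by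
      rw [Finset.sum_eq_single i] <;> simp +contextual [simpleRoot]
    rw [h2] at h1
    linarith
  have hnn (i : ι) : 0 ≤ o i := abs_nonneg (v i)
  have ho0 : o ≠ 0 := norm_pos_iff.1 (by rw [hon]; exact one_pos)
  refine ⟨o, ⟨μ, hμ0, ?_, ho0⟩, hon, ?_⟩
  · rw [Module.End.mem_eigenspace_iff]
    ext i
    simpa [Matrix.mulVec, dotProduct] using heig i
  · by_contra! hc
    obtain ⟨i₀, hi₀⟩ := hc
    obtain ⟨j₀, hj₀⟩ : ∃ j, o j ≠ 0 := by
      by_contra! hz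
      exact ho0 (by ext j; exact hz j)
    obtain ⟨i, hi, j, hj, hij⟩ := hirr {i | o i = 0} ⟨i₀, le_antisymm hi₀ (hnn i₀)⟩ ⟨j₀, hj₀⟩
    have hi' : o i = 0 := hi
    have h1 := heig i
    rw [hi', mul_zero, Finset.sum_eq_zero_iff_of_nonpos] at h1
    · exact mul_ne_zero hij hj (h1 j (Finset.mem_univ j))
    · intro l _
      by_cases hil : i = l
      · rw [← hil, hi', mul_zero]
      · exact mul_nonpos_of_nonpos_of_nonneg (hoff i l hil) (hnn l)

/-- The functional `v ↦ |v|₁`. -/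
noncomputable def heightForm (A : Matrix ι ι ℝ) : Module.Dual ℝ (EuclideanSpace ℝ ι) where
  toFun := height A
  map_add' u v := by simp [height, mul_add, Finset.sum_add_distrib]
  map_smul' c v := by
    simp only [height, PiLp.smul_apply, smul_eq_mul, Finset.mul_sum, RingHom.id_apply]
    exact Finset.sum_congr rfl fun i _ => by ring

theorem exists_gramForm_neg (h : 0 < sigNeg (gramForm A).toQuadraticMap) :
    ∃ v, gramForm A v v < 0 := by
  obtain ⟨V, hV, hneg⟩ := exists_finrank_eq_sigNeg_and_negDef (gramForm A).toQuadraticMap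
  have : Nontrivial V := Module.nontrivial_of_finrank_pos (R := ℝ) (by rw [hV]; exact h)
  obtain ⟨v, hv⟩ := exists_ne (0 : V)
  exact ⟨v, by simpa using hneg v hv⟩

/-- In signature `(n - 1, 1)` the form is positive on the orthogonal complement of a timelike
vector: the plane spanned by that vector and an orthogonal one is not negative semidefinite. -/
theorem gramForm_pos_of_orthogonal (hA : A.IsSymm)
    (hsig : HasSignature A (Fintype.card ι - 1) 1) {o u : EuclideanSpace ℝ ι}
    (ho : gramForm A o o < 0) (hou : gramForm A o u = 0) (hu : u ≠ 0) : 0 < gramForm A u u := by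
  by_contra! hc
  have hind : LinearIndependent ℝ ![o, u] := by
    refine LinearIndependent.pair_iff.2 fun s t hst => ?_
    have h1 := congrArg (gramForm A o) hst
    simp only [map_add, map_smul, hou, smul_eq_mul, mul_zero, add_zero, map_zero] at h1
    have hs : s = 0 := (mul_eq_zero.1 h1).resolve_right ho.ne
    rw [hs, zero_smul, zero_add] at hst
    exact ⟨hs, (smul_eq_zero.1 hst).resolve_right hu⟩
  have hle := QuadraticForm.sigPos_add_finrank_le_of_nonpos
    (Q := (gramForm A).toQuadraticMap) (V := Submodule.span ℝ (Set.range ![o, u])) (by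
      intro x hx
      rw [Matrix.range_cons_cons_empty, Submodule.mem_span_pair] at hx
      obtain ⟨s, t, rfl⟩ := hx
      simp only [LinearMap.BilinMap.toQuadraticMap_apply, map_add, map_smul, LinearMap.add_apply,
        LinearMap.smul_apply, smul_eq_mul, gramForm_comm hA u o, hou]
      nlinarith [mul_self_nonneg s, mul_self_nonneg t,
        mul_nonneg (mul_self_nonneg s) (neg_nonneg.2 ho.le),
        mul_nonneg (mul_self_nonneg t) (neg_nonneg.2 hc)])
  rw [finrank_span_eq_card hind, hsig.1, finrank_euclideanSpace, Fintype.card_fin] at hle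
  lia

theorem isTimeOriented_heightForm (hA : A.IsSymm) (hoff : ∀ i j, i ≠ j → A i j ≤ 0)
    (hsig : HasSignature A (Fintype.card ι - 1) 1) (hirr : IsIrreducibleGram A) :
    IsTimeOriented (gramForm A) (heightForm A) := by
  refine ⟨gramForm_comm hA, fun u hu hu0 => ?_⟩
  obtain ⟨⟨μ, hμ, heig, -⟩, hn, -⟩ : IsNormalizedEigenvector A (normalizedEigenvector A) :=
    Classical.epsilon_spec (exists_isNormalizedEigenvector hA hoff
      (exists_gramForm_neg (by rw [hsig.2]; exact one_pos)) hirr)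
  set o := normalizedEigenvector A with ho
  have hB (v : EuclideanSpace ℝ ι) : gramForm A o v = μ * height A v := by
    rw [gramForm_comm hA, gramForm_eq_sum_left, height, Finset.mul_sum]
    refine Finset.sum_congr rfl fun i _ => ?_
    have := congrArg (fun x : EuclideanSpace ℝ ι => x i) (Module.End.mem_eigenspace_iff.1 heig)
    simp only [Matrix.toLpLin_apply, Matrix.mulVec, dotProduct, PiLp.smul_apply,
      smul_eq_mul] at this
    rw [gramForm_simpleRoot_left, this]
    ring
  refine gramForm_pos_of_orthogonal hA hsig (o := o) ?_ ?_ hu0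
  · have h1 : height A o = 1 := by
      have : ‖o‖ ^ 2 = height A o := by
        rw [EuclideanSpace.norm_sq_eq, height]
        exact Finset.sum_congr rfl fun i _ => by rw [Real.norm_eq_abs, sq_abs, sq]
      rw [← this, hn, one_pow]
    rw [hB, h1, mul_one]
    exact hμ
  · rw [hB]
    have : height A u = 0 := hu
    rw [this, mul_zero]

/-- A form of signature `(n - 1, 0)` is positive semidefinite with a nonzero radical. -/
theorem exists_radical_vector [Nonempty ι] (hA : A.IsSymm)
    (hsig : HasSignature A (Fintype.card ι - 1) 0) :
    ∃ v ≠ 0, ∀ i, gramForm A (simpleRoot i) v = 0 := by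
  have hpos (u : EuclideanSpace ℝ ι) : 0 ≤ gramForm A u u := by
    by_contra! hc
    have hu : u ≠ 0 := by rintro rfl; simp at hc
    have h1 : Module.finrank ℝ (Submodule.span ℝ {u}) ≤ _ :=
      le_sigNeg_of_negDef (gramForm A).toQuadraticMap (by
        rintro ⟨x, hx⟩ hx0
        obtain ⟨c, rfl⟩ := Submodule.mem_span_singleton.1 hx
        have hc0 : c ≠ 0 := by rintro rfl; simp at hx0
        simp only [QuadraticMap.restrict_apply, neg_apply,
          LinearMap.BilinMap.toQuadraticMap_apply, map_smul, LinearMap.smul_apply, smul_eq_mul]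
        nlinarith [mul_pos (mul_self_pos.2 hc0) (neg_pos.2 hc)])
    rw [finrank_span_singleton hu, hsig.2] at h1
    lia
  obtain ⟨v, hv0, hv⟩ : ∃ v ≠ 0, gramForm A v v ≤ 0 := by
    by_contra! hc
    have h1 : Module.finrank ℝ (⊤ : Submodule ℝ (EuclideanSpace ℝ ι)) ≤ _ :=
      le_sigPos_of_posDef (gramForm A).toQuadraticMap (by
        intro x hx
        exact hc x (by simpa using hx))
    rw [finrank_top, finrank_euclideanSpace, hsig.1] at h1
    have := Fintype.card_pos (α := ι)
    lia
  exact ⟨v, hv0, gramForm_simpleRoot_eq_zero hA hpos (le_antisymm hv (hpos v))⟩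

/-- For an affine subset `J`, the span of the roots in `J` contains a nonzero null vector that is
orthogonal to all these roots. -/
theorem exists_null_vector_of_isAffineSubset (hA : A.IsSymm) {J : Finset ι}
    (hJ : IsAffineSubset A J) :
    ∃ δ ≠ 0, gramForm A δ δ = 0 ∧ ∀ j ∈ J, gramForm A (simpleRoot j) δ = 0 := by
  obtain ⟨hne, hsig⟩ := hJ
  have : Nonempty J := hne.to_subtype
  obtain ⟨v, hv0, hv⟩ := exists_radical_vector (hA.submatrix _) (by
    rw [Fintype.card_coe]
    exact hsig)
  set δ : EuclideanSpace ℝ ι := WithLp.toLp 2 fun i => if h : i ∈ J then v ⟨i, h⟩ else 0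
  have hδ (i : ι) : δ i = if h : i ∈ J then v ⟨i, h⟩ else 0 := rfl
  have horth (j : ι) (hj : j ∈ J) : gramForm A (simpleRoot j) δ = 0 := by
    have h1 := hv ⟨j, hj⟩
    rw [gramForm_simpleRoot_left] at h1 ⊢
    rw [← h1, ← Finset.sum_subset (Finset.subset_univ J), ← Finset.sum_coe_sort]
    · exact Finset.sum_congr rfl fun i _ => by simp [hδ]
    · intro i _ hi
      simp [hδ, hi]
  refine ⟨δ, ?_, ?_, horth⟩
  · intro h0
    refine hv0 ?_
    ext i
    have := hδ i
    rw [dif_pos i.2, h0] at this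
    exact this.symm
  · rw [gramForm_eq_sum_left]
    refine Finset.sum_eq_zero fun i _ => ?_
    by_cases hi : i ∈ J
    · rw [horth i hi, mul_zero]
    · rw [hδ, dif_neg hi, zero_mul]

end Gram

/-! ### The Coxeter group as a discrete group of isometries -/

section Action

variable {ι : Type*} [Fintype ι] [DecidableEq ι] {M : CoxeterMatrix ι} {W : Type*} [Group W]
  (cs : CoxeterSystem M W) {A : Matrix ι ι ℝ} (hA : IsCoxeterGram M A)

theorem linearAction_inv_apply (w : W) (v : EuclideanSpace ℝ ι) :
    linearAction cs hA w⁻¹ (linearAction cs hA w v) = v := by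
  rw [← Module.End.mul_apply, ← map_mul, inv_mul_cancel, map_one, Module.End.one_apply]

theorem linearAction_apply_inv (w : W) (v : EuclideanSpace ℝ ι) :
    linearAction cs hA w (linearAction cs hA w⁻¹ v) = v := by
  rw [← Module.End.mul_apply, ← map_mul, mul_inv_cancel, map_one, Module.End.one_apply]

theorem preservesCone_linearAction {f : Module.Dual ℝ (EuclideanSpace ℝ ι)}
    (h : IsTimeOriented (gramForm A) f) (w : W) :
    PreservesCone (gramForm A) f (linearAction cs hA w) := by
  have hd (i : ι) : gramForm A (simpleRoot i) (simpleRoot i) = 1 := by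
    rw [gramForm_simpleRoot, hA.apply_self]
  induction w using cs.simple_induction with
  | simple i =>
    rw [linearAction_simple]
    exact ⟨h.bReflection_bReflection (by rw [hd]; exact one_ne_zero),
      fun x => h.bReflection_pos (by rw [hd]; exact one_pos)⟩
  | one => exact ⟨fun u v => by simp, fun x _ hx => by simpa using hx⟩
  | mul w w' hw hw' =>
    rw [map_mul]
    exact ⟨fun u v => by rw [Module.End.mul_apply, Module.End.mul_apply, hw.form, hw'.form],
      fun x hx fx => hw.pos _ (by rwa [hw'.form]) (hw'.pos x hx fx)⟩

/-- The positive definite form obtained from `B` by changing the sign on the line of a timelike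
vector `x`. -/
noncomputable def timelikeNorm (A : Matrix ι ι ℝ) (x v : EuclideanSpace ℝ ι) : ℝ :=
  gramForm A v v - 2 * (gramForm A x v) ^ 2 / gramForm A x x

theorem continuous_timelikeNorm (A : Matrix ι ι ℝ) (x : EuclideanSpace ℝ ι) :
    Continuous (timelikeNorm A x) :=
  (continuous_gramForm_self A).sub
    ((continuous_const.mul ((continuous_gramForm_right A x).pow 2)).div_const _)

theorem timelikeNorm_smul (A : Matrix ι ι ℝ) (x v : EuclideanSpace ℝ ι) (c : ℝ) :
    timelikeNorm A x (c • v) = c ^ 2 * timelikeNorm A x v := by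
  simp only [timelikeNorm, map_smul, LinearMap.smul_apply, smul_eq_mul]
  ring

theorem timelikeNorm_pos {f : Module.Dual ℝ (EuclideanSpace ℝ ι)}
    (h : IsTimeOriented (gramForm A) f) {x v : EuclideanSpace ℝ ι} (hx : gramForm A x x < 0)
    (hv : v ≠ 0) : 0 < timelikeNorm A x v := by
  obtain ⟨t, u, hu, rfl⟩ : ∃ (t : ℝ) (u : EuclideanSpace ℝ ι),
      gramForm A x u = 0 ∧ v = t • x + u :=
    ⟨gramForm A x v / gramForm A x x, v - (gramForm A x v / gramForm A x x) • x, by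
      simp [hx.ne], by simp⟩
  have e : timelikeNorm A x (t • x + u) = gramForm A u u - t ^ 2 * gramForm A x x := by
    simp only [timelikeNorm, map_add, map_smul, LinearMap.add_apply, LinearMap.smul_apply,
      smul_eq_mul, h.symm u x, hu]
    have := hx.ne
    field_simp
    ring
  rw [e]
  by_cases h0 : u = 0
  · subst h0
    have ht : t ≠ 0 := by rintro rfl; simp at hv
    have : 0 < t ^ 2 := by positivity
    simp only [map_zero]
    nlinarith
  · have := h.pos_of_orthogonal hx hu h0
    nlinarith [sq_nonneg t]

theorem exists_le_timelikeNorm {f : Module.Dual ℝ (EuclideanSpace ℝ ι)}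
    (h : IsTimeOriented (gramForm A) f) {x : EuclideanSpace ℝ ι} (hx : gramForm A x x < 0) :
    ∃ c > 0, ∀ v, c * ‖v‖ ^ 2 ≤ timelikeNorm A x v := by
  have hmem {v : EuclideanSpace ℝ ι} (hv : 0 < ‖v‖) : ‖v‖⁻¹ • v ∈ Metric.sphere 0 1 := by
    simp [norm_smul, hv.ne']
  have hx0 : 0 < ‖x‖ := norm_pos_iff.2 (by rintro rfl; simp at hx)
  obtain ⟨z, hz, hmin⟩ := (isCompact_sphere (0 : EuclideanSpace ℝ ι) 1).exists_isMinOn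
    ⟨_, hmem hx0⟩ (continuous_timelikeNorm A x).continuousOn
  have hz1 : ‖z‖ = 1 := by simpa using hz
  refine ⟨timelikeNorm A x z, timelikeNorm_pos h hx (norm_pos_iff.1 (by rw [hz1]; exact one_pos)),
    fun v => ?_⟩
  rcases eq_or_lt_of_le (norm_nonneg v) with h0 | h0
  · simp [norm_eq_zero.1 h0.symm, timelikeNorm]
  · have h1 : timelikeNorm A x z ≤ timelikeNorm A x (‖v‖⁻¹ • v) := hmin (hmem h0)
    rw [timelikeNorm_smul, inv_pow, ← div_eq_inv_mul] at h1
    exact (le_div_iff₀ (by positivity)).1 h1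

/-- An element fixing a timelike vector has finite order: its powers preserve a positive definite
form, so two of them are arbitrarily close, and their quotient is then trivial because a nontrivial
element moves some simple root far away. -/
theorem isOfFinOrder_of_linearAction_eq {f : Module.Dual ℝ (EuclideanSpace ℝ ι)}
    (h : IsTimeOriented (gramForm A) f) {x : EuclideanSpace ℝ ι} (hx : gramForm A x x < 0)
    {w : W} (hw : linearAction cs hA w x = x) : IsOfFinOrder w := by
  obtain ⟨c, hc, hle⟩ := exists_le_timelikeNorm h hx
  have hfix (n : ℕ) : linearAction cs hA (w ^ n) x = x := by
    induction n with
    | zero => simp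
    | succ n ih => rw [pow_succ, map_mul, Module.End.mul_apply, hw, ih]
  have hinv (n : ℕ) (v : EuclideanSpace ℝ ι) :
      timelikeNorm A x (linearAction cs hA (w ^ n) v) = timelikeNorm A x v := by
    have hg := preservesCone_linearAction cs hA h (w ^ n)
    have h1 := hg.form x v
    rw [hfix] at h1
    rw [timelikeNorm, hg.form, h1, timelikeNorm]
  let s (n : ℕ) (i : ι) : EuclideanSpace ℝ ι := linearAction cs hA (w ^ n) (simpleRoot i)
  obtain ⟨R, hR⟩ : ∃ R, ∀ n, s n ∈ Metric.closedBall 0 R := by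
    refine ⟨∑ i, (timelikeNorm A x (simpleRoot i) / c + 1), fun n => ?_⟩
    have hb (i : ι) : ‖s n i‖ ≤ timelikeNorm A x (simpleRoot i) / c + 1 := by
      have h1 := hle (s n i)
      rw [hinv] at h1
      have h2 : ‖s n i‖ ^ 2 ≤ timelikeNorm A x (simpleRoot i) / c := by
        rw [le_div_iff₀ hc]
        linarith
      nlinarith [sq_nonneg (‖s n i‖ - 1)]
    have hnn (i : ι) : 0 ≤ timelikeNorm A x (simpleRoot i) / c + 1 := (norm_nonneg _).trans (hb i)
    rw [mem_closedBall_zero_iff, pi_norm_le_iff_of_nonneg (Finset.sum_nonneg fun i _ => hnn i)]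
    exact fun i => (hb i).trans
      (Finset.single_le_sum (f := fun i => timelikeNorm A x (simpleRoot i) / c + 1)
        (fun i _ => hnn i) (Finset.mem_univ i))
  obtain ⟨a, -, φ, hφ, hlim⟩ := tendsto_subseq_of_bounded Metric.isBounded_closedBall hR
  obtain ⟨ε, hε, hsmall⟩ : ∃ ε > 0, ∀ v : EuclideanSpace ℝ ι, ‖v‖ < ε → timelikeNorm A x v < c := by
    have h0 : timelikeNorm A x 0 < c := by simpa [timelikeNorm] using hc
    have := (continuous_timelikeNorm A x).continuousAt.eventually (gt_mem_nhds h0)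
    obtain ⟨ε, hε, h1⟩ := Metric.eventually_nhds_iff.1 this
    exact ⟨ε, hε, fun v hv => h1 (by simpa using hv)⟩
  obtain ⟨N, hN⟩ := Metric.cauchySeq_iff.1 hlim.cauchySeq ε hε
  have hlt : φ N < φ (N + 1) := hφ (Nat.lt_succ_self N)
  obtain ⟨d, hd⟩ := Nat.exists_eq_add_of_lt hlt
  refine isOfFinOrder_iff_pow_eq_one.2 ⟨d + 1, Nat.succ_pos d, ?_⟩
  by_contra hne
  obtain ⟨i, hi⟩ := exists_linearAction_simpleRoot_nonpos cs hA hne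
  set v := linearAction cs hA (w ^ (d + 1)) (simpleRoot i) - simpleRoot i with hv
  have hvs : linearAction cs hA (w ^ φ N) v = s (φ (N + 1)) i - s (φ N) i := by
    rw [hv, map_sub, ← Module.End.mul_apply, ← map_mul, ← pow_add]
    simp only [s, hd, add_assoc]
  have h1 : timelikeNorm A x v < c := by
    rw [← hinv (φ N), hvs]
    refine hsmall _ ?_
    rw [← dist_eq_norm]
    exact (dist_le_pi_dist _ _ i).trans_lt (hN (N + 1) (Nat.le_succ N) N le_rfl)
  have h2 : ‖v‖ < 1 := by
    have := hle v
    by_contra! hcon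
    nlinarith [mul_le_mul_of_nonneg_left (one_le_pow₀ hcon (n := 2)) hc.le]
  have h3 : |v i| ≤ ‖v‖ := PiLp.norm_apply_le v i
  have h4 : v i = linearAction cs hA (w ^ (d + 1)) (simpleRoot i) i - 1 := by
    simp [hv, simpleRoot]
  have := neg_abs_le (v i)
  linarith

/-- A vector orthogonal to the roots in `J` is fixed by the special subgroup of `J`. -/
theorem linearAction_eq_of_mem_specialSubgroup {J : Finset ι} {δ : EuclideanSpace ℝ ι}
    (hδ : ∀ j ∈ J, gramForm A (simpleRoot j) δ = 0) {w : W} (hw : w ∈ specialSubgroup cs J) :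
    linearAction cs hA w δ = δ := by
  induction hw using Subgroup.closure_induction with
  | mem w hw =>
    obtain ⟨j, hj, rfl⟩ := hw
    rw [linearAction_simple, bReflection_apply, hδ j hj]
    simp
  | one => simp
  | mul w w' _ _ hw hw' => rw [map_mul, Module.End.mul_apply, hw', hw]
  | inv w _ hw =>
    conv_lhs => rw [← hw]
    exact linearAction_inv_apply cs hA w δ

end Action

end CoxeterHilbert

open CoxeterHilbert in
theorem proposition4p6 {ι : Type*} [Fintype ι] [DecidableEq ι] {W : Type*} [Group W]
    (M : CoxeterMatrix ι) (cs : CoxeterSystem M W)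
    (A : Matrix ι ι ℝ) (hA : IsCoxeterGram M A)
    (hsig : HasSignature A (Fintype.card ι - 1) 1) (hirr : IsIrreducibleGram A)
    (J : Finset ι) (hJ : IsAffineSubset A J)
    (w : W) (hw : w ∈ specialSubgroup cs J) (hinf : ¬ IsOfFinOrder w) :
    IsParabolicIsometryOf (domain A) (hilbertDist (domainBoundary A))
        (normalizedAction cs hA w) ∧
      ∃ ξ ∈ domainBoundary A, linearAction cs hA w ξ = ξ ∧
        ∀ η ∈ domainBoundary A, normalizedAction cs hA w η = η → η = ξ := by
  have h := isTimeOriented_heightForm hA.symm (fun _ _ => hA.nonpos) hsig hirr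
  have hg := preservesCone_linearAction cs hA h
  obtain ⟨δ, hδ0, hδδ, hδ⟩ := exists_null_vector_of_isAffineSubset hA.symm hJ
  have hheight : heightForm A δ ≠ 0 := fun h0 => (h.pos_of_ker δ h0 hδ0).ne' hδδ
  set ξ := (heightForm A δ)⁻¹ • δ
  have hξ : ξ ∈ chartBoundary (gramForm A) (heightForm A) := by
    refine ⟨?_, ?_⟩
    · rw [map_smul, smul_eq_mul, inv_mul_cancel₀ hheight]
    · simp [ξ, hδδ]
  have hgξ : linearAction cs hA w ξ = ξ := by
    rw [map_smul, linearAction_eq_of_mem_specialSubgroup cs hA hδ hw]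
  have hfix (x) (hx : x ∈ chartDomain (gramForm A) (heightForm A)) :
      linearAction cs hA w x ≠ x :=
    fun hwx => hinf (isOfFinOrder_of_linearAction_eq cs hA h hx.2 hwx)
  exact ⟨(hg w).isParabolicIsometryOf h (hg w⁻¹) (linearAction_inv_apply cs hA w)
    (linearAction_apply_inv cs hA w) hξ hgξ hfix, ξ, hξ, hgξ,
    fun η hη he => (hg w).eq_of_chartAction_eq h hξ hgξ hfix hη he⟩
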